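/- A skew (left) brace is a set $B$ with two group structures $(B,+)$ and $(B,\cdot)$, neither assumed commutative, such that $a(b+c)=ab-a+ac$ for all $a,b,c\in B$; the two identity elements then coincide and are denoted by $0$. Put $\lambda_a(b)=-a+ab$ and $a*b=-a+ab-b$. An ideal of $B$ is a subset that is a normal subgroup of both $(B,+)$ and $(B,\cdot)$ and is invariant under all maps $\lambda_b$, $b\in B$; the quotient of $B$ by an ideal is again a skew brace. Let $$\operatorname{Soc}(B)=\operatorname{Ker}\lambda\cap Z(B,+),\qquad \zeta(B)=\operatorname{Soc}(B)\cap Z(B,\cdot),$$ where $Z$ denotes the centre of a group; $\zeta(B)$ is an ideal of $B$. The upper central series of $B$ is given by $\zeta_0(B)=\{0\}$ and $\zeta_{n+1}(B)/\zeta_n(B)=\zeta\big(B/\zeta_n(B)\big)$ for $n\ge 0$. The lower central series is given by $\Gamma_1(B)=B$ and, for $n\geq 1$, by letting $\Gamma_{n+1}(B)$ be the subgroup of $(B,+)$ generated by all elements $x*b$, $b*x$ and $x+b-x-b$ with $x\in\Gamma_n(B)$ and $b\in B$. The skew brace $B$ is supersoluble if it has a finite chain of ideals $\{0\}=I_0\leq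 I_1\leq\dots\leq I_m=B$ such that, for each $0\le i<m$, either $(I_{i+1}/I_i,+)$ is infinite cyclic and $I_{i+1}/I_i\leq\operatorname{Soc}(B/I_i)$, or $I_{i+1}/I_i$ has prime order. **Theorem.** Let $B$ be a supersoluble skew brace, and let $n\geq 0$ be an integer such that $B/\zeta_n(B)$ is finite. Then $\Gamma_{n+1}(B)$ is finite. -/

import Mathlib

/-- A skew left brace: a set with two (not necessarily commutative) group structures
`(B, +)` and `(B, *)` such that `a * (b + c) = a * b - a + a * c`. The two identity elements
`0` and `1` then coincide (`SkewBrace.one_eq_zero`). -/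
class SkewBrace (B : Type*) extends Group B, AddGroup B where
  mul_add_brace : ∀ a b c : B, a * (b + c) = a * b - a + a * c

namespace SkewBrace

variable {B : Type*} [SkewBrace B]

theorem one_eq_zero : (1 : B) = 0 := by
  have h := mul_add_brace (1 : B) 0 0
  simp only [one_mul, add_zero, zero_sub] at h
  exact (neg_eq_zero.mp h.symm)

/-- The map `lam a b = λ_a(b) = -a + a b`. -/
def lam (a b : B) : B := -a + a * b

/-- The star operation `a ∗ b = -a + a b - b`. -/
def star (a b : B) : B := -a + a * b - b

theorem mul_eq (a b : B) : a * b = a + lam a b := by simp [lam]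

theorem mul_zero' (a : B) : a * (0 : B) = a := by
  rw [← one_eq_zero, mul_one]

theorem lam_one (b : B) : lam 1 b = b := by
  simp [lam, one_eq_zero (B := B)]

theorem lam_add (a b c : B) : lam a (b + c) = lam a b + lam a c := by
  simp [lam, mul_add_brace, sub_eq_add_neg, add_assoc]

theorem lam_zero (a : B) : lam a 0 = 0 := by
  simp [lam, mul_zero']

theorem lam_neg (a b : B) : lam a (-b) = -lam a b := by
  rw [eq_neg_iff_add_eq_zero, ← lam_add, neg_add_cancel, lam_zero]

theorem lam_mul (a b c : B) : lam (a * b) c = lam a (lam b c) := by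
  have h : lam a (-b + b * c) = lam a (-b) + lam a (b * c) := lam_add _ _ _
  rw [lam_neg] at h
  change _ = lam a (-b + b * c)
  rw [h]
  simp [lam, mul_assoc, add_assoc]

end SkewBrace

open SkewBrace in
/-- An ideal of a skew brace: a subgroup of both `(B, +)` and `(B, *)` which is invariant under
all the maps `λ_b` and is normal in both groups. -/
structure BraceIdeal (B : Type*) [SkewBrace B] extends AddSubgroup B where
  one_mem : (1 : B) ∈ carrier
  mul_mem : ∀ {x y : B}, x ∈ carrier → y ∈ carrier → x * y ∈ carrier
  inv_mem : ∀ {x : B}, x ∈ carrier → x⁻¹ ∈ carrier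
  lam_mem : ∀ (b : B) {x : B}, x ∈ carrier → lam b x ∈ carrier
  add_conj_mem : ∀ (b : B) {x : B}, x ∈ carrier → b + x - b ∈ carrier
  mul_conj_mem : ∀ (b : B) {x : B}, x ∈ carrier → b * x * b⁻¹ ∈ carrier

namespace BraceIdeal

open SkewBrace

variable {B : Type*} [SkewBrace B]

instance normal (I : BraceIdeal B) : I.toAddSubgroup.Normal :=
  ⟨fun x hx b => by simpa [sub_eq_add_neg] using I.add_conj_mem b hx⟩

/-- Additive and multiplicative left cosets of an ideal coincide. -/
theorem neg_add_mem_iff (I : BraceIdeal B) (a b : B) :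
    -a + b ∈ I.toAddSubgroup ↔ a⁻¹ * b ∈ I.toAddSubgroup := by
  have e : -a + b = lam a (a⁻¹ * b) := by simp [lam]
  constructor
  · intro h
    have h2 := I.lam_mem a⁻¹ h
    rw [e, ← lam_mul, inv_mul_cancel, lam_one] at h2
    exact h2
  · intro h
    rw [e]
    exact I.lam_mem a h

/-- The underlying set of the quotient brace `B / I`, i.e. the set of cosets `b + I = b I`. -/
def Quotient (I : BraceIdeal B) : Type _ := B ⧸ I.toAddSubgroup

instance (I : BraceIdeal B) : AddGroup I.Quotient :=
  inferInstanceAs (AddGroup (B ⧸ I.toAddSubgroup))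

/-- The projection `B → B / I`, as a homomorphism of additive groups. -/
def proj (I : BraceIdeal B) : B →+ I.Quotient := QuotientAddGroup.mk' I.toAddSubgroup

theorem proj_eq_iff (I : BraceIdeal B) {a b : B} :
    I.proj a = I.proj b ↔ a⁻¹ * b ∈ I.toAddSubgroup := by
  rw [← neg_add_mem_iff]
  exact QuotientAddGroup.eq

theorem proj_surjective (I : BraceIdeal B) : Function.Surjective I.proj :=
  QuotientAddGroup.mk'_surjective _

theorem proj_mul_congr (I : BraceIdeal B) {a a' b b' : B} (ha : I.proj a = I.proj a')
    (hb : I.proj b = I.proj b') : I.proj (a * b) = I.proj (a' * b') := by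
  rw [proj_eq_iff] at *
  have h1 := I.mul_mem (I.mul_conj_mem b⁻¹ ha) hb
  have e : b⁻¹ * (a⁻¹ * a') * b⁻¹⁻¹ * (b⁻¹ * b') = (a * b)⁻¹ * (a' * b') := by group
  rw [e] at h1
  exact h1

theorem proj_inv_congr (I : BraceIdeal B) {a a' : B} (ha : I.proj a = I.proj a') :
    I.proj a⁻¹ = I.proj a'⁻¹ := by
  rw [proj_eq_iff] at *
  have h1 := I.mul_conj_mem a (I.inv_mem ha)
  have e : a * (a⁻¹ * a')⁻¹ * a⁻¹ = a⁻¹⁻¹ * a'⁻¹ := by group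
  rw [e] at h1
  exact h1

instance (I : BraceIdeal B) : Mul I.Quotient where
  mul := Quotient.map₂ (· * ·) fun _ _ ha _ _ hb => _root_.Quotient.exact
    (I.proj_mul_congr (_root_.Quotient.sound ha) (_root_.Quotient.sound hb))

instance (I : BraceIdeal B) : Inv I.Quotient where
  inv := Quotient.map (·⁻¹) fun _ _ ha => _root_.Quotient.exact
    (I.proj_inv_congr (_root_.Quotient.sound ha))

instance (I : BraceIdeal B) : One I.Quotient := ⟨I.proj 1⟩

theorem proj_mul (I : BraceIdeal B) (a b : B) : I.proj (a * b) = I.proj a * I.proj b := rfl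

theorem proj_inv (I : BraceIdeal B) (a : B) : I.proj a⁻¹ = (I.proj a)⁻¹ := rfl

theorem proj_one (I : BraceIdeal B) : I.proj 1 = 1 := rfl

/-- The quotient brace `B / I`; its operations are induced by those of `B`. -/
instance (I : BraceIdeal B) : SkewBrace I.Quotient where
  toGroup :=
    { mul_assoc := fun x y z => by
        obtain ⟨a, rfl⟩ := I.proj_surjective x
        obtain ⟨b, rfl⟩ := I.proj_surjective y
        obtain ⟨c, rfl⟩ := I.proj_surjective z
        simp only [← proj_mul, mul_assoc]
      one_mul := fun x => by
        obtain ⟨a, rfl⟩ := I.proj_surjective x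
        rw [← proj_one, ← proj_mul, one_mul]
      mul_one := fun x => by
        obtain ⟨a, rfl⟩ := I.proj_surjective x
        rw [← proj_one, ← proj_mul, mul_one]
      inv_mul_cancel := fun x => by
        obtain ⟨a, rfl⟩ := I.proj_surjective x
        rw [← proj_inv, ← proj_mul, inv_mul_cancel, proj_one] }
  toAddGroup := inferInstance
  mul_add_brace := fun x y z => by
    obtain ⟨a, rfl⟩ := I.proj_surjective x
    obtain ⟨b, rfl⟩ := I.proj_surjective y
    obtain ⟨c, rfl⟩ := I.proj_surjective z
    rw [← map_add, ← proj_mul, mul_add_brace, map_add, map_sub]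
    rfl

theorem proj_lam (I : BraceIdeal B) (a b : B) : I.proj (lam a b) = lam (I.proj a) (I.proj b) := by
  simp only [lam, map_add, map_neg]
  rfl

/-- The zero ideal `{0}`. -/
def zero (B : Type*) [SkewBrace B] : BraceIdeal B where
  toAddSubgroup := ⊥
  one_mem := one_eq_zero
  mul_mem := by
    rintro x y (rfl : x = 0) (rfl : y = 0)
    exact mul_zero' 0
  inv_mem := by
    rintro x (rfl : x = 0)
    change (0 : B)⁻¹ = 0
    rw [← one_eq_zero, inv_one]
  lam_mem := by
    rintro b x (rfl : x = 0)
    exact lam_zero b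
  add_conj_mem := by
    rintro b x (rfl : x = 0)
    change b + 0 - b = 0
    simp
  mul_conj_mem := by
    rintro b x (rfl : x = 0)
    change b * 0 * b⁻¹ = 0
    rw [mul_zero', mul_inv_cancel, one_eq_zero]

/-- The preimage in `B` of an ideal of `B / I`. -/
def comapProj (I : BraceIdeal B) (J : BraceIdeal I.Quotient) : BraceIdeal B where
  toAddSubgroup := J.toAddSubgroup.comap I.proj
  one_mem := J.one_mem
  mul_mem := fun {x y} hx hy => by
    change I.proj (x * y) ∈ J.toAddSubgroup
    rw [proj_mul]
    exact J.mul_mem hx hy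
  inv_mem := fun {x} hx => by
    change I.proj x⁻¹ ∈ J.toAddSubgroup
    rw [proj_inv]
    exact J.inv_mem hx
  lam_mem := fun b {x} hx => by
    change I.proj (lam b x) ∈ J.toAddSubgroup
    rw [proj_lam]
    exact J.lam_mem _ hx
  add_conj_mem := fun b {x} hx => by
    change I.proj (b + x - b) ∈ J.toAddSubgroup
    rw [map_sub, map_add]
    exact J.add_conj_mem _ hx
  mul_conj_mem := fun b {x} hx => by
    change I.proj (b * x * b⁻¹) ∈ J.toAddSubgroup
    rw [proj_mul, proj_mul, proj_inv]
    exact J.mul_conj_mem _ hx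

end BraceIdeal

namespace SkewBrace

variable (B : Type*) [SkewBrace B]

/-- `Soc(B) = Ker λ ∩ Z(B, +)`, as a set. -/
def socle : Set B :=
  {a : B | (∀ b : B, lam a b = b) ∧ (∀ b : B, a + b = b + a)}

/-- `ζ(B) = Soc(B) ∩ Z(B, *)`, as a set. -/
def centerSet : Set B :=
  {a : B | a ∈ socle B ∧ ∀ b : B, a * b = b * a}

variable {B}

theorem mul_eq_add_of_mem {a : B} (h : a ∈ centerSet B) (b : B) : a * b = a + b := by
  rw [mul_eq, h.1.1]

theorem lam_of_mem {a : B} (h : a ∈ centerSet B) (b : B) : lam b a = a := by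
  have h1 := mul_eq b a
  rw [← h.2, mul_eq_add_of_mem h, h.1.2] at h1
  exact (add_left_cancel h1).symm

theorem mul_mem_centerSet {x y : B} (hx : x ∈ centerSet B) (hy : y ∈ centerSet B) :
    x * y ∈ centerSet B := by
  refine ⟨⟨fun b => by rw [lam_mul, hy.1.1, hx.1.1], fun b => ?_⟩, fun b => ?_⟩
  · rw [mul_eq_add_of_mem hx, add_assoc, hy.1.2, ← add_assoc, hx.1.2, add_assoc]
  · rw [mul_assoc, hy.2, ← mul_assoc, hx.2, mul_assoc]

theorem inv_eq_neg_of_mem {x : B} (hx : x ∈ centerSet B) : x⁻¹ = -x := by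
  have h := mul_eq_add_of_mem hx x⁻¹
  rw [mul_inv_cancel, one_eq_zero] at h
  exact (neg_eq_of_add_eq_zero_right h.symm).symm

theorem inv_mem_centerSet {x : B} (hx : x ∈ centerSet B) : x⁻¹ ∈ centerSet B := by
  refine ⟨⟨fun b => ?_, fun b => ?_⟩, fun b => ?_⟩
  · conv_lhs => rw [← hx.1.1 b]
    rw [← lam_mul, inv_mul_cancel, lam_one]
  · rw [inv_eq_neg_of_mem hx]
    have h : AddCommute x b := hx.1.2 b
    exact h.neg_left
  · have h : Commute x b := hx.2 b
    exact h.inv_left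

theorem one_mem_centerSet : (1 : B) ∈ centerSet B :=
  ⟨⟨lam_one, fun b => by simp [one_eq_zero (B := B)]⟩, fun b => by simp⟩

/-- The centre `ζ(B) = Soc(B) ∩ Z(B, *)`, as an ideal of `B`. -/
def center (B : Type*) [SkewBrace B] : BraceIdeal B where
  carrier := centerSet B
  zero_mem' := by
    rw [← one_eq_zero]
    exact one_mem_centerSet
  add_mem' := fun {x y} hx hy => by
    rw [← mul_eq_add_of_mem hx]
    exact mul_mem_centerSet hx hy
  neg_mem' := fun {x} hx => by
    rw [← inv_eq_neg_of_mem hx]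
    exact inv_mem_centerSet hx
  one_mem := one_mem_centerSet
  mul_mem := mul_mem_centerSet
  inv_mem := inv_mem_centerSet
  lam_mem := fun b {x} hx => by
    rwa [lam_of_mem hx]
  add_conj_mem := fun b {x} hx => by
    rwa [← hx.1.2, add_sub_cancel_right]
  mul_conj_mem := fun b {x} hx => by
    rwa [← hx.2, mul_inv_cancel_right]

/-- The finite terms of the upper central series: `ζ_0(B) = {0}`, and `ζ_{n+1}(B)` is the ideal
with `ζ_{n+1}(B) / ζ_n(B) = ζ(B / ζ_n(B))`. -/
def zetaSeries (B : Type*) [SkewBrace B] : ℕ → BraceIdeal B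
  | 0 => BraceIdeal.zero B
  | n + 1 => (zetaSeries B n).comapProj (center (zetaSeries B n).Quotient)

/-- `X ∗ Y`: the subgroup of `(B, +)` generated by all `x ∗ y` with `x ∈ X` and `y ∈ Y`. -/
def starSubgroup (X Y : Set B) : AddSubgroup B :=
  AddSubgroup.closure {z : B | ∃ x ∈ X, ∃ y ∈ Y, star x y = z}

/-- The lower central series, indexed from `1`: `Γ_1(B) = B` and, for `n ≥ 1`, `Γ_{n+1}(B)` is the
subgroup of `(B, +)` generated by `Γ_n(B) ∗ B`, `B ∗ Γ_n(B)` and `[Γ_n(B), B]_+`. The index `0` is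
not used; there the value is `B`. -/
def gammaSeries (B : Type*) [SkewBrace B] : ℕ → AddSubgroup B
  | 0 => ⊤
  | 1 => ⊤
  | n + 2 =>
      starSubgroup (gammaSeries B (n + 1) : Set B) Set.univ ⊔
        starSubgroup Set.univ (gammaSeries B (n + 1) : Set B) ⊔
        ⁅gammaSeries B (n + 1), (⊤ : AddSubgroup B)⁆

/-- For ideals `I ≤ J`, the factor `J / I` as a subgroup of the additive group of `B / I`. -/
def factor (I J : BraceIdeal B) : AddSubgroup I.Quotient := J.toAddSubgroup.map I.proj

/-- `B` is supersoluble: there is a finite chain `{0} = I_0 ≤ I_1 ≤ ... ≤ I_n = B` of ideals of `B`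
such that each factor `I_{i+1} / I_i` either is additively infinite cyclic and contained in
`Soc(B / I_i)`, or has prime order. -/
def IsSupersoluble (B : Type*) [SkewBrace B] : Prop :=
  ∃ (n : ℕ) (I : ℕ → BraceIdeal B),
    (I 0).toAddSubgroup = ⊥ ∧ (I n).toAddSubgroup = ⊤ ∧
    ∀ i < n, (I i).toAddSubgroup ≤ (I (i + 1)).toAddSubgroup ∧
      ((IsAddCyclic (factor (I i) (I (i + 1))) ∧ Infinite (factor (I i) (I (i + 1))) ∧
          (factor (I i) (I (i + 1)) : Set (I i).Quotient) ⊆ socle (I i).Quotient) ∨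
        (Nat.card (factor (I i) (I (i + 1)))).Prime)

end SkewBrace

/-! The heart is a Schur-type statement, `finite_braceCommutator`: an ideal I that is finite modulo
the centre has finite commutator [I, B], provided torsion additive subgroups are finite. Since (I,
+) is central-by-finite, transfer gives k > 0 such that x ↦ kx is additive on I with values in ζ(B).
Central elements are fixed by every λ_b and by conjugation, so k annihilates b * x and x + b - x -
b. For x * b, some power of x under the product is central; following λ along the powers of x shows
that a multiple of x * b vanishes. So [I, B] lies in the torsion subgroup of I. Supersolubility
makes torsion subgroups finite in every quotient of B, since the chain has cyclic factors. Induction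
on j then shows that B/ζ_{m+j}(B) finite forces the image of Γ_{j+1}(B) in B/ζ_m(B) to be finite;
the theorem is the case m = 0. -/

/-! ### Power maps on central-by-finite groups -/

/-- If `f : G → Q` has finite range and central kernel, then for some `k > 0` the map
`x ↦ x ^ k` is a homomorphism from `G` into the kernel of `f`. -/
theorem MonoidHom.exists_pow_mul_distrib {G Q : Type*} [Group G] [Group Q] (f : G →* Q)
    (hfin : Finite f.range) (hf : ∀ x, f x = 1 → ∀ y, x * y = y * x) :
    ∃ k : ℕ, 0 < k ∧ (∀ x, f (x ^ k) = 1) ∧ ∀ x y : G, (x * y) ^ k = x ^ k * y ^ k := by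
  have hle : f.ker ≤ Subgroup.center G := fun x hx =>
    Subgroup.mem_center_iff.mpr fun y => (hf x (f.mem_ker.mp hx) y).symm
  have hker : f.ker.FiniteIndex := Subgroup.finiteIndex_ker f
  have hcenter : (Subgroup.center G).FiniteIndex := Subgroup.finiteIndex_of_le hle
  -- The index of the centre makes the power map a homomorphism (it is the transfer into the
  -- centre); the index of the kernel then sends its values into the kernel.
  refine ⟨(Subgroup.center G).index * f.ker.index,
    Nat.mul_pos (Nat.pos_of_ne_zero hcenter.index_ne_zero)
      (Nat.pos_of_ne_zero hker.index_ne_zero), fun x => ?_, fun x y => ?_⟩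
  · rw [pow_mul]
    exact f.mem_ker.mp (f.ker.pow_index_mem _)
  · have h : (x * y) ^ (Subgroup.center G).index =
        x ^ (Subgroup.center G).index * y ^ (Subgroup.center G).index :=
      congrArg Subtype.val (map_mul (MonoidHom.transferCenterPow G) x y)
    have hc : Commute (x ^ (Subgroup.center G).index) (y ^ (Subgroup.center G).index) :=
      (Subgroup.mem_center_iff.mp ((Subgroup.center G).pow_index_mem x) _).symm
    simp only [pow_mul]
    rw [h, hc.mul_pow]

theorem AddMonoidHom.exists_nsmul_add_distrib {G Q : Type*} [AddGroup G] [AddGroup Q]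
    (f : G →+ Q) (hfin : Finite f.range) (hf : ∀ x, f x = 0 → ∀ y, x + y = y + x) :
    ∃ k : ℕ, 0 < k ∧ (∀ x, f (k • x) = 0) ∧ ∀ x y : G, k • (x + y) = k • x + k • y :=
  MonoidHom.exists_pow_mul_distrib (AddMonoidHom.toMultiplicative f) hfin hf

/-! ### Finiteness of torsion subgroups -/

/-- A torsion additive group which is cyclic is finite. -/
theorem finite_of_isAddCyclic_of_torsion {G : Type*} [AddGroup G] [IsAddCyclic G]
    (h : ∀ x : G, IsOfFinAddOrder x) : Finite G := by
  obtain ⟨g, hg⟩ := IsAddCyclic.exists_zsmul_surjective (G := G)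
  have hfin : Finite (AddSubgroup.zmultiples g) := (h g).finite_zmultiples
  exact Finite.of_surjective (fun x : AddSubgroup.zmultiples g => (x : G)) fun x => by
    obtain ⟨n, hn⟩ := hg x
    exact ⟨⟨x, n, hn⟩, rfl⟩

/-- In a homomorphic image of a group with a finite normal chain whose factors are cyclic, every
torsion subgroup is finite. -/
theorem finite_of_torsion_of_cyclic_chain {G Q : Type*} [AddGroup G] [AddGroup Q]
    {f : G →+ Q} (hf : Function.Surjective f) {N : ℕ → AddSubgroup G} (hN : ∀ i, (N i).Normal)
    (h0 : N 0 = ⊥) {m : ℕ}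
    (hstep : ∀ i < m, ∃ g, ∀ x ∈ N (i + 1), ∃ k : ℤ, -(k • g) + x ∈ N i)
    (H : AddSubgroup Q) (hH : ∀ x ∈ H, IsOfFinAddOrder x) (hle : H ≤ (N m).map f) :
    Finite H := by
  induction m generalizing H with
  | zero =>
    rw [h0, AddSubgroup.map_bot, le_bot_iff] at hle
    subst hle
    infer_instance
  | succ m ih =>
    have : ((N m).map f).Normal := (hN m).map f hf
    -- The kernel of `p` is the part of `H` inside the image of `N m`, covered by induction; its
    -- range is torsion inside a cyclic group.
    let p : H →+ Q ⧸ (N m).map f := (QuotientAddGroup.mk' _).comp H.subtype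
    have hker : Finite p.ker := by
      have hfin := ih (fun i hi => hstep i (by omega)) (H ⊓ (N m).map f)
        (fun x hx => hH x hx.1) inf_le_right
      refine Finite.of_injective (β := ↥(H ⊓ (N m).map f))
        (fun x => ⟨x.1.1, x.1.2, (QuotientAddGroup.eq_zero_iff _).mp x.2⟩) fun x y hxy => ?_
      exact Subtype.ext (Subtype.ext (congrArg (fun z => z.1) hxy))
    have hrange : Finite p.range := by
      obtain ⟨g, hg⟩ := hstep m (Nat.lt_succ_self m)
      have hcyc : p.range ≤ AddSubgroup.zmultiples (QuotientAddGroup.mk' ((N m).map f) (f g)) := by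
        rintro _ ⟨x, rfl⟩
        obtain ⟨y, hy, hyx⟩ := hle x.2
        obtain ⟨k, hk⟩ := hg y hy
        refine ⟨k, ?_⟩
        change k • QuotientAddGroup.mk' ((N m).map f) (f g) = QuotientAddGroup.mk' _ x.1
        rw [← hyx, ← map_zsmul, ← map_zsmul]
        refine QuotientAddGroup.eq.mpr ⟨_, hk, ?_⟩
        simp
      have : IsAddCyclic p.range :=
        isAddCyclic_of_injective (AddSubgroup.inclusion hcyc) (AddSubgroup.inclusion_injective hcyc)
      refine finite_of_isAddCyclic_of_torsion ?_
      rintro ⟨_, x, rfl⟩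
      have hx : IsOfFinAddOrder x := (AddSubmonoid.isOfFinAddOrder_coe (x := x)).mp (hH x x.2)
      exact (AddSubmonoid.isOfFinAddOrder_coe (H := p.range.toAddSubmonoid)).mp (p.isOfFinAddOrder hx)
    exact p.finite_iff_finite_ker_range.mpr ⟨hker, hrange⟩

namespace SkewBrace

theorem IsSupersoluble.finite_of_torsion {B : Type*} [SkewBrace B] (hB : IsSupersoluble B)
    (J : BraceIdeal B) (H : AddSubgroup J.Quotient) (hH : ∀ x ∈ H, IsOfFinAddOrder x) :
    Finite H := by
  obtain ⟨m, I, h0, hm, hI⟩ := hB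
  refine finite_of_torsion_of_cyclic_chain (N := fun i => (I i).toAddSubgroup) (m := m)
    J.proj_surjective (fun i => (I i).normal) h0 (fun i hi => ?_) H hH ?_
  -- Both kinds of factor are cyclic; a generator lifts to `g`.
  · have hcyc : IsAddCyclic (factor (I i) (I (i + 1))) := by
      rcases (hI i hi).2 with h | h
      · exact h.1
      · have := Fact.mk h
        exact isAddCyclic_of_prime_card rfl
    obtain ⟨⟨_, g, hgI, rfl⟩, hg⟩ := hcyc.exists_zsmul_surjective
    refine ⟨g, fun x hx => ?_⟩
    obtain ⟨k, hk⟩ := hg ⟨(I i).proj x, x, hx, rfl⟩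
    refine ⟨k, QuotientAddGroup.eq.mp ?_⟩
    change (I i).proj (k • g) = (I i).proj x
    rw [map_zsmul]
    exact congrArg Subtype.val hk
  · rw [hm]
    intro x _
    obtain ⟨y, rfl⟩ := J.proj_surjective x
    exact ⟨y, trivial, rfl⟩

/-! ### Commutators of ideals and the lower central series -/

open scoped addCommutatorElement

variable {B : Type*} [SkewBrace B]

theorem star_eq (a b : B) : star a b = lam a b - b := rfl

theorem proj_star (I : BraceIdeal B) (a b : B) :
    I.proj (star a b) = star (I.proj a) (I.proj b) := by
  rw [star_eq, star_eq, map_sub, I.proj_lam]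

theorem lam_nsmul (a : B) (k : ℕ) (b : B) : lam a (k • b) = k • lam a b :=
  map_nsmul (AddMonoidHom.mk' (lam a) (lam_add a)) k b

theorem proj_center_eq_zero_iff {x : B} : (center B).proj x = 0 ↔ x ∈ centerSet B :=
  QuotientAddGroup.eq_zero_iff _

/-- The commutator of an additive subgroup `I` of `B` with `B`. -/
def braceCommutator (I : AddSubgroup B) : AddSubgroup B :=
  starSubgroup (I : Set B) Set.univ ⊔ starSubgroup Set.univ (I : Set B) ⊔ ⁅I, (⊤ : AddSubgroup B)⁆

theorem braceCommutator_le {I K : AddSubgroup B} (h1 : ∀ x ∈ I, ∀ b, star x b ∈ K)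
    (h2 : ∀ x ∈ I, ∀ b, star b x ∈ K) (h3 : ∀ x ∈ I, ∀ b, x + b - x - b ∈ K) :
    braceCommutator I ≤ K := by
  refine sup_le (sup_le ?_ ?_) ?_
  · refine (AddSubgroup.closure_le _).mpr ?_
    rintro _ ⟨x, hx, b, -, rfl⟩
    exact h1 x hx b
  · refine (AddSubgroup.closure_le _).mpr ?_
    rintro _ ⟨b, -, x, hx, rfl⟩
    exact h2 x hx b
  · refine AddSubgroup.addCommutator_le.mpr fun x hx b _ => ?_
    simpa [addCommutatorElement_def, sub_eq_add_neg] using h3 x hx b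

theorem star_mem_braceCommutator {I : AddSubgroup B} {x : B} (hx : x ∈ I) (b : B) :
    star x b ∈ braceCommutator I :=
  AddSubgroup.mem_sup_left (AddSubgroup.mem_sup_left
    (AddSubgroup.subset_closure ⟨x, hx, b, trivial, rfl⟩))

theorem star_mem_braceCommutator' {I : AddSubgroup B} {x : B} (hx : x ∈ I) (b : B) :
    star b x ∈ braceCommutator I :=
  AddSubgroup.mem_sup_left (AddSubgroup.mem_sup_right
    (AddSubgroup.subset_closure ⟨b, trivial, x, hx, rfl⟩))

theorem addCommutator_mem_braceCommutator {I : AddSubgroup B} {x : B} (hx : x ∈ I) (b : B) :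
    x + b - x - b ∈ braceCommutator I := by
  have h : ⁅x, b⁆ ∈ braceCommutator I :=
    AddSubgroup.mem_sup_right
      (AddSubgroup.addCommutator_mem_addCommutator hx (AddSubgroup.mem_top b))
  simpa [addCommutatorElement_def, sub_eq_add_neg] using h

/-- An additive subgroup `I` with `[I, B] ≤ I`; this is the same as an ideal. -/
structure AbsorbsStar (I : AddSubgroup B) : Prop where
  star_mem : ∀ x ∈ I, ∀ b, star x b ∈ I
  lam_mem : ∀ x ∈ I, ∀ b, lam b x ∈ I
  add_conj_mem : ∀ x ∈ I, ∀ b, b + x - b ∈ I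

/-- λ_b(x) = b * x + x, and b + x - b = -(x + b - x - b) + x. -/
theorem AbsorbsStar.of_le {I : AddSubgroup B} (h : braceCommutator I ≤ I) : AbsorbsStar I where
  star_mem x hx b := h (star_mem_braceCommutator hx b)
  lam_mem x hx b := by
    have h1 := I.add_mem (h (star_mem_braceCommutator' hx b)) hx
    rwa [star_eq, sub_add_cancel] at h1
  add_conj_mem x hx b := by
    have h1 := I.add_mem (I.neg_mem (h (addCommutator_mem_braceCommutator hx b))) hx
    simpa [sub_eq_add_neg, add_assoc] using h1

theorem AbsorbsStar.braceCommutator_le {I : AddSubgroup B} (h : AbsorbsStar I) :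
    braceCommutator I ≤ I := by
  refine SkewBrace.braceCommutator_le h.star_mem
    (fun x hx b => I.sub_mem (h.lam_mem x hx b) hx) fun x hx b => ?_
  have h1 := I.add_mem hx (h.add_conj_mem _ (I.neg_mem hx) b)
  simpa [sub_eq_add_neg, add_assoc] using h1

theorem AbsorbsStar.pow_mem {I : AddSubgroup B} (h : AbsorbsStar I) {x : B} (hx : x ∈ I)
    (k : ℕ) : x ^ k ∈ I := by
  induction k with
  | zero => rw [pow_zero, one_eq_zero]; exact I.zero_mem
  | succ k ih =>
    rw [pow_succ, mul_eq]
    exact I.add_mem ih (h.lam_mem x hx _)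

theorem braceCommutator_mono {I J : AddSubgroup B} (h : I ≤ J) :
    braceCommutator I ≤ braceCommutator J :=
  braceCommutator_le (fun _ hx => star_mem_braceCommutator (h hx))
    (fun _ hx => star_mem_braceCommutator' (h hx))
    fun _ hx => addCommutator_mem_braceCommutator (h hx)

/-- `gammaSeries B (n + 2)` unfolds to `braceCommutator (gammaSeries B (n + 1))`, so monotonicity of
the commutator makes the series descend. -/
theorem absorbsStar_gammaSeries (n : ℕ) : AbsorbsStar (gammaSeries B (n + 1)) := by
  refine AbsorbsStar.of_le ?_
  induction n with
  | zero => exact le_top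
  | succ n ih => exact braceCommutator_mono ih

theorem AbsorbsStar.map_proj {I : AddSubgroup B} (h : AbsorbsStar I) (J : BraceIdeal B) :
    AbsorbsStar (I.map J.proj) where
  star_mem := by
    rintro _ ⟨x, hx, rfl⟩ b
    obtain ⟨b, rfl⟩ := J.proj_surjective b
    exact ⟨_, h.star_mem x hx b, proj_star J x b⟩
  lam_mem := by
    rintro _ ⟨x, hx, rfl⟩ b
    obtain ⟨b, rfl⟩ := J.proj_surjective b
    exact ⟨_, h.lam_mem x hx b, J.proj_lam b x⟩
  add_conj_mem := by
    rintro _ ⟨x, hx, rfl⟩ b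
    obtain ⟨b, rfl⟩ := J.proj_surjective b
    exact ⟨_, h.add_conj_mem x hx b, by rw [map_sub, map_add]⟩

theorem map_braceCommutator_le (J : BraceIdeal B) (I : AddSubgroup B) :
    (braceCommutator I).map J.proj ≤ braceCommutator (I.map J.proj) := by
  rw [AddSubgroup.map_le_iff_le_comap]
  refine braceCommutator_le (fun x hx b => ?_) (fun x hx b => ?_) fun x hx b => ?_
  · rw [AddSubgroup.mem_comap, proj_star]
    exact star_mem_braceCommutator (AddSubgroup.mem_map_of_mem J.proj hx) _
  · rw [AddSubgroup.mem_comap, proj_star]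
    exact star_mem_braceCommutator' (AddSubgroup.mem_map_of_mem J.proj hx) _
  · rw [AddSubgroup.mem_comap, map_sub, map_sub, map_add]
    exact addCommutator_mem_braceCommutator (AddSubgroup.mem_map_of_mem J.proj hx) _

/-! ### Ideals that are finite modulo the centre -/

/-- Every element of an ideal that is finite modulo the centre has a central power. -/
theorem exists_pow_mem_center {I : AddSubgroup B} (hI : AbsorbsStar I)
    (hfin : Finite (I.map (center B).proj)) {x : B} (hx : x ∈ I) :
    ∃ m : ℕ, 0 < m ∧ x ^ m ∈ centerSet B := by
  obtain ⟨i, j, hij, h⟩ := Finite.exists_ne_map_eq_of_infinite fun k : ℕ =>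
    (⟨(center B).proj (x ^ k), _, hI.pow_mem hx k, rfl⟩ : I.map (center B).proj)
  have key : ∀ i j : ℕ, i < j → (center B).proj (x ^ i) = (center B).proj (x ^ j) →
      ∃ m : ℕ, 0 < m ∧ x ^ m ∈ centerSet B := fun i j hlt h => by
    refine ⟨j - i, Nat.sub_pos_of_lt hlt, ?_⟩
    -- Additive and multiplicative cosets of the centre agree, so equal classes of two powers put
    -- their multiplicative quotient in the centre.
    have h1 := (center B).proj_eq_iff.mp h
    rwa [← Nat.add_sub_cancel' hlt.le, pow_add, inv_mul_cancel_left] at h1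
  have h' : (center B).proj (x ^ i) = (center B).proj (x ^ j) := congrArg Subtype.val h
  rcases lt_or_gt_of_ne hij with hlt | hlt
  · exact key i j hlt h'
  · exact key j i hlt h'.symm

/-- Modulo the kernel of multiplication by k on I, the displacement y_j = λ_{x^j}(b) - b grows
linearly in j, because λ_x fixes the central element k y_j. It vanishes at j = m, so mk annihilates
x * b. -/
theorem isOfFinAddOrder_star_of_nsmul {I : AddSubgroup B} (hI : AbsorbsStar I) {k : ℕ}
    (hk : 0 < k) (hcen : ∀ x ∈ I, k • x ∈ centerSet B)
    (hadd : ∀ x ∈ I, ∀ y ∈ I, k • (x + y) = k • x + k • y) {x : B} (hx : x ∈ I)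
    {m : ℕ} (hm : 0 < m) (hxm : x ^ m ∈ centerSet B) (b : B) :
    IsOfFinAddOrder (star x b) := by
  have key : ∀ j : ℕ, ∃ y ∈ I, lam (x ^ j) b = y + b ∧ k • y = (j * k) • star x b := by
    intro j
    induction j with
    | zero => exact ⟨0, I.zero_mem, by simp [lam_one], by simp⟩
    | succ j ih =>
      obtain ⟨y, hy, hyb, hky⟩ := ih
      have hs := hI.star_mem x hx b
      have hl := hI.lam_mem y hy x
      refine ⟨lam x y + star x b, I.add_mem hl hs, ?_, ?_⟩
      · rw [pow_succ', lam_mul, hyb, lam_add, star_eq, add_assoc, sub_add_cancel]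
      · rw [hadd _ hl _ hs, ← lam_nsmul, lam_of_mem (hcen y hy), hky, ← add_nsmul, Nat.succ_mul]
  obtain ⟨y, -, hy, hky⟩ := key m
  rw [hxm.1.1] at hy
  have hy0 : y = 0 := by simpa using hy
  rw [hy0, nsmul_zero] at hky
  exact isOfFinAddOrder_iff_nsmul_eq_zero.mpr ⟨m * k, Nat.mul_pos hm hk, hky.symm⟩

/-- If `I` is an ideal which is finite modulo the centre and torsion additive subgroups of `B` are
finite, then the commutator of `I` with `B` is finite. -/
theorem finite_braceCommutator {I : AddSubgroup B} (hI : AbsorbsStar I)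
    (hfin : Finite (I.map (center B).proj))
    (htors : ∀ H : AddSubgroup B, (∀ x ∈ H, IsOfFinAddOrder x) → Finite H) :
    Finite (braceCommutator I) := by
  obtain ⟨k, hk, hcen, hadd⟩ : ∃ k : ℕ, 0 < k ∧ (∀ x ∈ I, k • x ∈ centerSet B) ∧
      ∀ x ∈ I, ∀ y ∈ I, k • (x + y) = k • x + k • y := by
    obtain ⟨k, hk, hcen, hadd⟩ :=
      ((center B).proj.comp I.subtype).exists_nsmul_add_distrib
        (by rwa [AddMonoidHom.range_comp, AddSubgroup.range_subtype]) fun x hx y =>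
          Subtype.ext ((proj_center_eq_zero_iff.mp hx).1.2 y)
    exact ⟨k, hk, fun x hx => proj_center_eq_zero_iff.mp (hcen ⟨x, hx⟩), fun x hx y hy =>
      congrArg Subtype.val (hadd ⟨x, hx⟩ ⟨y, hy⟩)⟩
  have hneg : ∀ x ∈ I, k • (-x) = -(k • x) := fun x _ => by simp
  let T : AddSubgroup B :=
    { carrier := {x | x ∈ I ∧ IsOfFinAddOrder x}
      zero_mem' := ⟨I.zero_mem, IsOfFinAddOrder.zero⟩
      neg_mem' := fun hx => ⟨I.neg_mem hx.1, hx.2.neg⟩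
      add_mem' := fun {x y} hx hy => by
        refine ⟨I.add_mem hx.1 hy.1, ?_⟩
        -- x and y need not commute, but kx and ky do, so k(x + y) = kx + ky is torsion, and hence
        -- so is x + y.
        have hc : AddCommute (k • x) (k • y) := (hcen x hx.1).1.2 _
        have h := hc.isOfFinAddOrder_add hx.2.nsmul hy.2.nsmul
        rw [← hadd x hx.1 y hy.1] at h
        exact h.of_nsmul hk.ne' }
  have hT : Finite T := htors T fun x hx => hx.2
  have htorsion : ∀ x : B, k • x = 0 → IsOfFinAddOrder x := fun x hx =>
    isOfFinAddOrder_iff_nsmul_eq_zero.mpr ⟨k, hk, hx⟩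
  have hle := hI.braceCommutator_le
  have hCT : braceCommutator I ≤ T := by
    refine braceCommutator_le (fun x hx b => ⟨hle (star_mem_braceCommutator hx b), ?_⟩)
      (fun x hx b => ⟨hle (star_mem_braceCommutator' hx b), htorsion _ ?_⟩)
      fun x hx b => ⟨hle (addCommutator_mem_braceCommutator hx b), htorsion _ ?_⟩
    · obtain ⟨m, hm, hxm⟩ := exists_pow_mem_center hI hfin hx
      exact isOfFinAddOrder_star_of_nsmul hI hk hcen hadd hx hm hxm b
    · rw [star_eq, sub_eq_add_neg, hadd _ (hI.lam_mem x hx b) _ (I.neg_mem hx), ← lam_nsmul,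
        lam_of_mem (hcen x hx), hneg x hx, add_neg_cancel]
    · have hx' := I.neg_mem hx
      -- The commutator is x plus a conjugate of -x; conjugation fixes the central element k(-x), so
      -- multiplication by k cancels the two terms.
      have e : x + b - x - b = x + (b + -x - b) := by simp [sub_eq_add_neg, add_assoc]
      have hconj : k • (b + -x - b) = b + k • (-x) - b := by
        rw [sub_eq_add_neg, sub_eq_add_neg]
        exact (map_nsmul (AddAut.addConj b) k (-x)).symm
      rw [e, hadd _ hx _ (hI.add_conj_mem _ hx' b), hconj, ← (hcen _ hx').1.2,
        add_sub_cancel_right, hneg x hx, add_neg_cancel]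
  exact Finite.of_injective _ (AddSubgroup.inclusion_injective hCT)

/-! ### Descent along the upper central series -/

/-- By definition ζ_{m+1}(B) is the preimage of ζ(B/ζ_m(B)), so B/ζ_{m+1}(B) maps onto the quotient
of B/ζ_m(B) by its centre, compatibly with the projections from B. -/
theorem finite_map_proj_center {m : ℕ} {I : AddSubgroup B}
    (h : Finite (I.map (zetaSeries B (m + 1)).proj)) :
    Finite ((I.map (zetaSeries B m).proj).map (center (zetaSeries B m).Quotient).proj) := by
  let f : (zetaSeries B (m + 1)).Quotient →+ (center (zetaSeries B m).Quotient).Quotient :=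
    QuotientAddGroup.lift _
      ((center (zetaSeries B m).Quotient).proj.comp (zetaSeries B m).proj)
      fun x hx => proj_center_eq_zero_iff.mpr hx
  have e : f.comp (zetaSeries B (m + 1)).proj =
      (center (zetaSeries B m).Quotient).proj.comp (zetaSeries B m).proj := rfl
  rw [AddSubgroup.map_map, ← e, ← AddSubgroup.map_map]
  exact Set.Finite.image f h

/-- Each step trades one term of the upper series for one of the lower: a finite image of Γ_{j+1}(B)
modulo ζ_{m+1}(B) is an ideal of B/ζ_m(B) that is finite modulo the centre, and its commutator
contains the image of Γ_{j+2}(B). Hence m varies in the induction. -/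
theorem IsSupersoluble.finite_map_gammaSeries (hB : IsSupersoluble B) (j m : ℕ)
    (h : Finite (zetaSeries B (m + j)).Quotient) :
    Finite ((gammaSeries B (j + 1)).map (zetaSeries B m).proj) := by
  induction j generalizing m with
  | zero => exact Finite.of_injective (β := (zetaSeries B m).Quotient) _ Subtype.val_injective
  | succ j ih =>
    have h1 := finite_map_proj_center (ih (m + 1) (by rwa [Nat.add_right_comm, Nat.add_assoc]))
    have h2 := finite_braceCommutator ((absorbsStar_gammaSeries j).map_proj (zetaSeries B m)) h1
      (hB.finite_of_torsion (zetaSeries B m))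
    exact Finite.of_injective _ (AddSubgroup.inclusion_injective
      (map_braceCommutator_le (zetaSeries B m) (gammaSeries B (j + 1))))

end SkewBrace

theorem theorem3p42 {B : Type*} [SkewBrace B] (hB : SkewBrace.IsSupersoluble B) (n : ℕ)
    (hn : Finite (SkewBrace.zetaSeries B n).Quotient) :
    Finite (SkewBrace.gammaSeries B (n + 1)) := by
  have h := hB.finite_map_gammaSeries n 0 (by rwa [Nat.zero_add])
  -- ζ_0(B) is zero, so the projection is injective and the finite image gives back Γ_{n+1}(B)
  -- itself.
  refine Finite.of_injective (fun x : SkewBrace.gammaSeries B (n + 1) =>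
    (⟨_, x.1, x.2, rfl⟩ : (SkewBrace.gammaSeries B (n + 1)).map
      (SkewBrace.zetaSeries B 0).proj)) fun x y hxy => ?_
  have h1 : -x.1 + y.1 = 0 := QuotientAddGroup.eq.mp (congrArg Subtype.val hxy)
  exact Subtype.ext (neg_add_eq_zero.mp h1)
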